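/- Let $p\ge 1$ be an integer and let $G$ be the Vilenkin group of all sequences $x=(x_j)_{j\in\mathbb Z}$ with $x_j\in\{0,\dots,p-1\}$ and $x_j=0$ for all sufficiently small $j$, with coordinatewise addition $\oplus$ modulo $p$, inverse operation $\ominus$, the group topology in which the sets $U_l=\{x: x_j=0 \text{ for } j\le l\}$, $l\in\mathbb Z$, are a neighbourhood basis of zero, and the Haar measure $\mu$ normalized by $\mu(U)=1$, where $U=U_0$. The dual group $G^*$ consists of the same sequences with the same structure (its measure is $\mu^*$, the set corresponding to $U$ is $U^*$), with the pairing $$\chi(x,\omega)=\exp\Big(\frac{2\pi i}{p}\sum_{j\in\mathbb Z}x_j\,\omega_{1-j}\Big),\qquad x\in G,\ \omega\in G^*.$$ Let $H=\{x\in G: x_j=0\text{ for } j>0\}$, let $H^\perp=\{\omega\in G^*:\chi(h,\omega)=1 \text{ for all } h\in H\}$, and let $(T_hf)(x)=f(x\ominus h)$. Let $f\mapsto\hat f$ be the Fourier transform $L^2(G)\to L^2(G^*)$, the continuous extension of $\hat f(\omega)=\int_G f(x)\overline{\chi(x,\omega)}\,d\mu(x)$ from $L^1(G)\cap L^2(G)$,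 and for $f,g\in L^2(G)$ put $$[\hat f,\hat g](\omega)=\sum_{h\in H^\perp}\hat f(\omega\oplus h)\,\overline{\hat g(\omega\oplus h)}.$$ **Theorem.** Let $\varphi\in L^2(G)$ and let $D>0$ be a real number. The series defining $[\hat\varphi,\hat\varphi](\omega)$ converges for almost every $\omega\in U^*$, and the following conditions are equivalent: 1. $\{T_h\varphi:h\in H\}$ is a Bessel sequence in $L^2(G)$ with bound $D$, that is, $\sum_{h\in H}|\langle f,T_h\varphi\rangle|^2\le D\|f\|^2$ for all $f\in L^2(G)$. 2. The synthesis operator $\Lambda^*:\ell^2(H)\to L^2(G)$, $\Lambda^*c=\sum_{h\in H}c_hT_h\varphi$, is well defined (the series converges unconditionally in $L^2(G)$ for every $c\in\ell^2(H)$) and $\|\Lambda^*\|\le\sqrt D$. 3. $[\hat\varphi,\hat\varphi](\omega)\le D$ for almost every $\omega\in U^*$. -/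

import Mathlib

open scoped ENNReal ComplexConjugate ComplexOrder InnerProductSpace

open MeasureTheory

noncomputable section

/-- The additive subgroup of `ℤ → ℤ/p` of all sequences that vanish at all indices below some `k`
depending on the sequence. -/
def vilenkinSubgroup (p : ℕ) : AddSubgroup (ℤ → ZMod p) where
  carrier := {x | ∃ k : ℤ, ∀ j < k, x j = 0}
  zero_mem' := ⟨0, fun _ _ => rfl⟩
  add_mem' := by
    rintro x y ⟨k, hk⟩ ⟨l, hl⟩
    refine ⟨min k l, fun j hj => ?_⟩
    simp [hk j (lt_of_lt_of_le hj (min_le_left _ _)), hl j (lt_of_lt_of_le hj (min_le_right _ _))]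
  neg_mem' := by
    rintro x ⟨k, hk⟩
    exact ⟨k, fun j hj => by simp [hk j hj]⟩

/-- The Vilenkin group `G`: sequences `(…, 0, 0, x_k, x_{k+1}, …)` indexed by `ℤ` with entries in
`{0, …, p - 1}`, with coordinatewise addition modulo `p`. -/
def Vilenkin (p : ℕ) : Type := ↥(vilenkinSubgroup p)

/-- The dual group `G*`, which consists of the same sequences, with the same operations, topology
and Haar measure; it is paired with `G` by `Vilenkin.character`. -/
abbrev VilenkinDual (p : ℕ) : Type := Vilenkin p

namespace Vilenkin

variable {p : ℕ}

instance instAddCommGroup : AddCommGroup (Vilenkin p) :=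
  inferInstanceAs (AddCommGroup ↥(vilenkinSubgroup p))

instance instCoeFun : CoeFun (Vilenkin p) (fun _ => ℤ → ZMod p) := ⟨fun x => x.1⟩

@[ext] theorem ext {x y : Vilenkin p} (h : ∀ j, x j = y j) : x = y := Subtype.ext (funext h)

@[simp] theorem zero_apply (j : ℤ) : (0 : Vilenkin p) j = 0 := rfl

@[simp] theorem add_apply (x y : Vilenkin p) (j : ℤ) : (x + y) j = x j + y j := rfl

@[simp] theorem neg_apply (x : Vilenkin p) (j : ℤ) : (-x) j = -x j := rfl

/-! ### Topology -/

/-- The neighbourhoods of zero `U_l = {x : x_j = 0 for j ≤ l}`. -/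
def U (p : ℕ) (l : ℤ) : Set (Vilenkin p) := {x | ∀ j ≤ l, x j = 0}

/-- The system `{U_l}` is a basis of neighbourhoods of zero for a group topology. -/
@[reducible]
def filterBasis (p : ℕ) : AddGroupFilterBasis (Vilenkin p) :=
  addGroupFilterBasisOfComm (Set.range (U p)) (Set.range_nonempty _)
    (by
      rintro _ _ ⟨k, rfl⟩ ⟨l, rfl⟩
      exact ⟨_, ⟨max k l, rfl⟩, fun x hx =>
        ⟨fun j hj => hx j (hj.trans (le_max_left _ _)),
          fun j hj => hx j (hj.trans (le_max_right _ _))⟩⟩)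
    (by
      rintro _ ⟨l, rfl⟩ j _
      rfl)
    (by
      rintro _ ⟨l, rfl⟩
      refine ⟨_, ⟨l, rfl⟩, ?_⟩
      rintro _ ⟨x, hx, y, hy, rfl⟩ j hj
      simp [hx j hj, hy j hj])
    (by
      rintro _ ⟨l, rfl⟩
      refine ⟨_, ⟨l, rfl⟩, fun x hx j hj => ?_⟩
      simp [hx j hj])

instance instTopologicalSpace : TopologicalSpace (Vilenkin p) := (filterBasis p).topology

instance instIsTopologicalAddGroup : IsTopologicalAddGroup (Vilenkin p) :=
  (filterBasis p).isTopologicalAddGroup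

instance instMeasurableSpace : MeasurableSpace (Vilenkin p) := borel _

instance instBorelSpace : BorelSpace (Vilenkin p) := ⟨rfl⟩

theorem mem_nhds_iff {s : Set (Vilenkin p)} {x : Vilenkin p} :
    s ∈ nhds x ↔ ∃ l : ℤ, ∀ y : Vilenkin p, (∀ j ≤ l, y j = x j) → y ∈ s := by
  rw [((filterBasis p).nhds_hasBasis x).mem_iff]
  constructor
  · rintro ⟨_, ⟨l, rfl⟩, h⟩
    refine ⟨l, fun y hy => h ⟨y - x, fun j hj => ?_, add_sub_cancel x y⟩⟩
    rw [sub_eq_add_neg, add_apply, neg_apply, hy j hj, add_neg_cancel]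
  · rintro ⟨l, h⟩
    refine ⟨_, ⟨l, rfl⟩, ?_⟩
    rintro _ ⟨y, hy, rfl⟩
    exact h _ fun j hj => by simp [hy j hj]

theorem isOpen_U (l : ℤ) : IsOpen (U p l) := by
  rw [isOpen_iff_mem_nhds]
  intro x hx
  exact mem_nhds_iff.2 ⟨l, fun y hy j hj => (hy j hj).trans (hx j hj)⟩

/-- The element of `U_l` whose coordinates at indices greater than `l` are those of `y`. -/
def cut (l : ℤ) (y : ℤ → ZMod p) : Vilenkin p :=
  ⟨fun j => if j ≤ l then 0 else y j, l, fun _ hj => if_pos hj.le⟩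

theorem continuous_cut (l : ℤ) : Continuous (cut (p := p) l) := by
  rw [continuous_iff_continuousAt]
  intro y s hs
  obtain ⟨m, hm⟩ := mem_nhds_iff.1 hs
  have hfin : (Set.Ioc l m).Finite := Set.finite_Ioc l m
  have hopen : IsOpen ((Set.Ioc l m).pi fun j => ({y j} : Set (ZMod p))) :=
    isOpen_set_pi hfin fun _ _ => isOpen_discrete _
  have hy : ((Set.Ioc l m).pi fun j => ({y j} : Set (ZMod p))) ∈ nhds y :=
    hopen.mem_nhds fun _ _ => rfl
  refine Filter.mem_map.2 (Filter.mem_of_superset hy fun z hz => hm _ fun j hj => ?_)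
  change (if j ≤ l then 0 else z j) = if j ≤ l then 0 else y j
  split_ifs with h
  · rfl
  · exact hz j ⟨not_le.1 h, hj⟩

theorem isCompact_U [NeZero p] (l : ℤ) : IsCompact (U p l) := by
  have h : Set.range (cut (p := p) l) = U p l := by
    ext x
    constructor
    · rintro ⟨y, rfl⟩ j hj
      exact if_pos hj
    · intro hx
      refine ⟨x, ext fun j => ?_⟩
      change (if j ≤ l then 0 else x j) = x j
      split_ifs with hj
      · exact (hx j hj).symm
      · rfl
  rw [← h]
  exact isCompact_range (continuous_cut l)

/-! ### Haar measure, `L²`, and the pairing with the dual group -/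

/-- `U = U_0` as a compact set with nonempty interior. -/
def unitBall (p : ℕ) [NeZero p] : TopologicalSpace.PositiveCompacts (Vilenkin p) where
  carrier := U p 0
  isCompact' := isCompact_U 0
  interior_nonempty' := ⟨0, by rw [(isOpen_U 0).interior_eq]; exact fun _ _ => rfl⟩

/-- The Haar measure, normalized so that `U = U_0` has measure `1`. -/
def haar (p : ℕ) [NeZero p] : Measure (Vilenkin p) := Measure.addHaarMeasure (unitBall p)

instance instIsAddHaarMeasure [NeZero p] : (haar p).IsAddHaarMeasure :=
  inferInstanceAs (Measure.addHaarMeasure (unitBall p)).IsAddHaarMeasure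

theorem haar_U_zero [NeZero p] : haar p (U p 0) = 1 := Measure.addHaarMeasure_self

/-- The Hilbert space `L²(G)` (or `L²(G*)`) of complex-valued functions. -/
abbrev L2 (p : ℕ) [NeZero p] : Type := Lp ℂ 2 (haar p)

/-- The pairing `χ(x, ω) = exp((2πi / p) ∑_j x_j ω_{1 - j})`. The sum has finitely many nonzero
terms, and only its class modulo `p` matters; `ZMod.stdAddChar` maps the class of `a` to
`exp(2πi a / p)`. -/
def character [NeZero p] (x : Vilenkin p) (ω : VilenkinDual p) : ℂ :=
  ZMod.stdAddChar (∑ᶠ j : ℤ, x j * ω (1 - j))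

theorem finite_support_pairing (x : Vilenkin p) (ω : VilenkinDual p) :
    (Function.support fun j : ℤ => x j * ω (1 - j)).Finite := by
  obtain ⟨k, hk⟩ := x.2
  obtain ⟨l, hl⟩ := ω.2
  refine (Set.finite_Icc k (1 - l)).subset fun j hj => ⟨?_, ?_⟩
  · by_contra h
    exact hj (mul_eq_zero_of_left (hk j (not_le.1 h)) _)
  · by_contra h
    exact hj (mul_eq_zero_of_right _ (hl (1 - j) (by omega)))

/-- The pairing in terms of the digits `0, …, p - 1`. -/
theorem character_eq_exp [NeZero p] (x : Vilenkin p) (ω : VilenkinDual p) :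
    character x ω = Complex.exp (2 * Real.pi * Complex.I / p *
      ((∑ᶠ j : ℤ, (x j).val * (ω (1 - j)).val : ℕ) : ℂ)) := by
  have hs : (Function.support fun j : ℤ => (x j).val * (ω (1 - j)).val).Finite := by
    obtain ⟨k, hk⟩ := x.2
    obtain ⟨l, hl⟩ := ω.2
    refine (Set.finite_Icc k (1 - l)).subset fun j hj => ⟨?_, ?_⟩
    · by_contra h
      exact hj (mul_eq_zero_of_left (by rw [hk j (not_le.1 h), ZMod.val_zero]) _)
    · by_contra h
      exact hj (mul_eq_zero_of_right _ (by rw [hl (1 - j) (by omega), ZMod.val_zero]))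
  have hc : ∑ᶠ j : ℤ, x j * ω (1 - j) =
      (((∑ᶠ j : ℤ, (x j).val * (ω (1 - j)).val : ℕ) : ℤ) : ZMod p) := by
    have := (Nat.castAddMonoidHom (ZMod p)).map_finsum hs
    simp only [Nat.coe_castAddMonoidHom, Nat.cast_mul, ZMod.natCast_zmod_val] at this
    rw [Int.cast_natCast, this]
  rw [character, hc, ZMod.stdAddChar_coe]
  congr 1
  push_cast
  ring

/-! ### The discrete subgroup, its annihilator, translations -/

/-- The discrete subgroup `H = {x : x_j = 0 for j > 0}` of `G`. -/
def H (p : ℕ) : AddSubgroup (Vilenkin p) where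
  carrier := {x | ∀ j > 0, x j = 0}
  zero_mem' := fun _ _ => rfl
  add_mem' := fun hx hy j hj => by simp [hx j hj, hy j hj]
  neg_mem' := fun hx j hj => by simp [hx j hj]

theorem character_add_right [NeZero p] (x : Vilenkin p) (ω ξ : VilenkinDual p) :
    character x (ω + ξ) = character x ω * character x ξ := by
  unfold character
  rw [← AddChar.map_add_eq_mul,
    ← finsum_add_distrib (finite_support_pairing x ω) (finite_support_pairing x ξ)]
  simp only [add_apply, mul_add]

theorem character_zero_right [NeZero p] (x : Vilenkin p) :
    character x (0 : VilenkinDual p) = 1 := by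
  simp [character]

/-- The annihilator `H^⊥ = {ω : χ(h, ω) = 1 for all h ∈ H}`, a subgroup of `G*`. -/
def annihilatorH (p : ℕ) [NeZero p] : AddSubgroup (VilenkinDual p) where
  carrier := {ω | ∀ h ∈ H p, character h ω = 1}
  zero_mem' := fun h _ => character_zero_right h
  add_mem' := fun ha hb h hh => by rw [character_add_right, ha h hh, hb h hh, one_mul]
  neg_mem' := fun {ω} ha h hh => by
    have := character_add_right h ω (-ω)
    rwa [add_neg_cancel, character_zero_right, ha h hh, one_mul, eq_comm] at this

/-- The annihilator in coordinates: `H^⊥ = {ω : ω_j = 0 for j > 0}`. -/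
theorem mem_annihilatorH_iff [NeZero p] {ω : VilenkinDual p} :
    ω ∈ annihilatorH p ↔ ∀ j > 0, ω j = 0 := by
  constructor
  · intro hω j hj
    let e : Vilenkin p := ⟨Pi.single (1 - j) 1, 1 - j, fun i hi => Pi.single_eq_of_ne hi.ne _⟩
    have he : e ∈ H p := fun i hi => Pi.single_eq_of_ne (by omega) _
    have h1 : character e ω = 1 := hω e he
    have h2 : ∑ᶠ i : ℤ, e i * ω (1 - i) = ω j := by
      rw [finsum_eq_single _ (1 - j) fun i hi => mul_eq_zero_of_left (Pi.single_eq_of_ne hi _) _]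
      change (Pi.single (1 - j) 1 : ℤ → ZMod p) (1 - j) * ω (1 - (1 - j)) = ω j
      rw [Pi.single_eq_same, one_mul, sub_sub_cancel]
    rw [character, h2, ← AddChar.map_zero_eq_one (ZMod.stdAddChar (N := p))] at h1
    exact ZMod.injective_stdAddChar h1
  · intro hω h hh
    have : ∀ i : ℤ, h i * ω (1 - i) = 0 := fun i => by
      rcases lt_or_ge 0 i with hi | hi
      · exact mul_eq_zero_of_left (hh i hi) _
      · exact mul_eq_zero_of_right _ (hω _ (by omega))
    simp [character, this]

/-- The translation `(T_h f)(x) = f(x ⊖ h)` on `L²(G)`. -/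
def translate [NeZero p] (h : Vilenkin p) (f : L2 p) : L2 p :=
  Lp.compMeasurePreserving (fun x => x - h) (measurePreserving_sub_right (haar p) h) f

/-! ### Fourier transform -/

/-- The Fourier integral `ω ↦ ∫_G f(x) conj χ(x, ω) dμ(x)`, meaningful for integrable `f`. -/
def fourierIntegral [NeZero p] (f : Vilenkin p → ℂ) (ω : VilenkinDual p) : ℂ :=
  ∫ x, f x * conj (character x ω) ∂(haar p)

open Classical in
/-- The Fourier integral of `f ∈ L¹(G) ∩ L²(G)` as an element of `L²(G*)`. -/
def fourierOnL1L2 [NeZero p] (f : L2 p) : L2 p :=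
  if h : MemLp (fourierIntegral f) 2 (haar p) then h.toLp else 0

/-- The Fourier transform on `L²(G)`: the extension by continuity of the Fourier integral from the
dense subspace `L¹(G) ∩ L²(G)`. -/
def fourier [NeZero p] (f : L2 p) : L2 p :=
  extendFrom {g : L2 p | Integrable g (haar p)} fourierOnL1L2 f

/-- The bracket `[f, g](ω) = ∑_{h ∈ H^⊥} f(ω ⊕ h) conj g(ω ⊕ h)` of two functions on `G*`. -/
def bracket [NeZero p] (f g : VilenkinDual p → ℂ) (ω : VilenkinDual p) : ℂ :=
  ∑' h : annihilatorH p, f (ω + h) * conj (g (ω + h))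

end Vilenkin

/-! ### Bessel sequences and synthesis operators -/

section Bessel

variable {ι E : Type*} [NormedAddCommGroup E] [InnerProductSpace ℂ E]

/-- The family `f` is a Bessel sequence with bound `D > 0`:
`∑_j |⟨g, f_j⟩|² ≤ D ‖g‖²` for all `g` (in particular the series converges). -/
def IsBesselWithBound (f : ι → E) (D : ℝ) : Prop :=
  0 < D ∧ ∀ g : E, Summable (fun j => ‖⟪f j, g⟫_ℂ‖ ^ 2) ∧ ∑' j, ‖⟪f j, g⟫_ℂ‖ ^ 2 ≤ D * ‖g‖ ^ 2

/-- `T` is the synthesis operator of the family `f`: for every `c ∈ ℓ²` the series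
`∑_j c_j f_j` converges, and its sum is `T c`. -/
def IsSynthesisOperator (f : ι → E) (T : lp (fun _ : ι => ℂ) 2 →L[ℂ] E) : Prop :=
  ∀ c : lp (fun _ : ι => ℂ) 2, HasSum (fun j => c j • f j) (T c)

end Bessel

end

/-!
The three conditions are all equivalent to the upper Riesz bound
`‖∑ c_h T_h φ‖² ≤ D ∑ |c_h|²` for finitely supported `c`.

For the first two conditions this is Hilbert space theory: the synthesis operator of a Bessel family
is the adjoint of its analysis operator (`IsBesselWithBound.exists_isSynthesisOperator`), it
restricts to finite sums (`IsSynthesisOperator.norm_sum_sq_le`), and the bound on finite sums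
implies the Bessel inequality by Cauchy–Schwarz (`isBesselWithBound_of_norm_sum_sq_le`).

For the third condition one passes to the Fourier side, where `∑ c_h T_h φ` becomes `m φ̂` with the
trigonometric polynomial `m = ∑ c_h conj χ(h, ·)`. As `m` is `H^⊥`-periodic and `U` is a fundamental
domain for `H^⊥`, `‖∑ c_h T_h φ‖² = ∫_U |m|² [φ̂, φ̂]` (`Vilenkin.enorm_sum_translate_sq`), while
`∫_U |m|² = ∑ |c_h|²` by orthonormality of the characters
(`Vilenkin.setLIntegral_enorm_trigPoly_sq`). So a bound `[φ̂, φ̂] ≤ D` gives the Riesz bound.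
Conversely, the multiples of the indicator functions of the cosets of `U_l` in `U`, `l ≥ 0`, are
trigonometric polynomials; testing with them shows `∫_C [φ̂, φ̂] ≤ D μ(C)` for each coset `C`, hence
for all Borel sets (`Vilenkin.measure_le_of_coset_le`), so that `[φ̂, φ̂] ≤ D` almost everywhere
(`Vilenkin.ae_ebracket_le`). The bracket is finite almost everywhere since its integral over `U` is
`‖φ̂‖²`.

All this rests on Plancherel's theorem (`Vilenkin.lintegral_enorm_fourierIntegral`). For
`f ∈ L¹ ∩ L²`, `|f̂|²` is the Fourier transform of the autocorrelation of `f`. Its integral over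
`U_{-n}` is the average of the autocorrelation over the annihilator `U_n`, which tends to the value
`‖f‖²` at zero because translation is continuous in `L²`. Density of `L¹ ∩ L²` then identifies the
Fourier transform with a linear isometry (`Vilenkin.fourier_eq`, `Vilenkin.norm_fourierCLM`).
-/

namespace Vilenkin

variable {p : ℕ}

/-! ### Topology of the Vilenkin group -/

theorem sub_apply (x y : Vilenkin p) (j : ℤ) : (x - y) j = x j - y j := rfl

/-- The sequence with entry `a` at the index `k` and zeros elsewhere. -/
noncomputable def single (k : ℤ) (a : ZMod p) : Vilenkin p :=
  ⟨Pi.single k a, k, fun _ hi => Pi.single_eq_of_ne hi.ne _⟩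

@[simp] theorem single_same (k : ℤ) (a : ZMod p) : single k a k = a :=
  Pi.single_eq_same (M := fun _ : ℤ => ZMod p) k a

theorem single_of_ne {k j : ℤ} (h : j ≠ k) (a : ZMod p) : single k a j = 0 :=
  Pi.single_eq_of_ne (M := fun _ : ℤ => ZMod p) h a

theorem single_mem_U {k l : ℤ} (h : l < k) (a : ZMod p) : single k a ∈ U p l :=
  fun _ hj => single_of_ne (by omega) a

theorem sub_mem_U_iff {x y : Vilenkin p} {l : ℤ} : x - y ∈ U p l ↔ ∀ j ≤ l, x j = y j :=
  forall₂_congr fun j _ => by rw [sub_apply, sub_eq_zero]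

theorem U_subset {k l : ℤ} (h : k ≤ l) : U p l ⊆ U p k := fun _ hx j hj => hx j (hj.trans h)

theorem measurableSet_U (l : ℤ) : MeasurableSet (U p l) := (isOpen_U l).measurableSet

/-- The sequence that agrees with `x` at indices at most `l` and vanishes at the others. -/
def trunc (l : ℤ) (x : Vilenkin p) : Vilenkin p :=
  ⟨fun j => if j ≤ l then x j else 0, by
    obtain ⟨k, hk⟩ := x.2
    exact ⟨k, fun j hj => by simp [hk j hj]⟩⟩

theorem trunc_apply (l : ℤ) (x : Vilenkin p) (j : ℤ) :
    trunc l x j = if j ≤ l then x j else 0 := rfl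

theorem sub_trunc_mem_U (l : ℤ) (x : Vilenkin p) : x - trunc l x ∈ U p l :=
  sub_mem_U_iff.2 fun j hj => by rw [trunc_apply, if_pos hj]

theorem finite_support_trunc (l : ℤ) (x : Vilenkin p) :
    (Function.support fun j => trunc l x j).Finite := by
  obtain ⟨k, hk⟩ := x.2
  refine (Set.finite_Icc k l).subset fun j hj => ⟨?_, ?_⟩
  · by_contra h
    exact hj (by simp [trunc_apply, hk j (not_le.1 h)])
  · by_contra h
    exact hj (by simp [trunc_apply, h])

theorem countable_finite_support [NeZero p] :
    {x : Vilenkin p | (Function.support fun j => x j).Finite}.Countable := by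
  refine Set.countable_iff_exists_injective.2 ?_
  obtain ⟨e, he⟩ := exists_injective_nat (ℤ →₀ ZMod p)
  refine ⟨fun x => e (Finsupp.ofSupportFinite (fun j => x.1 j) x.2), fun x y hxy => ?_⟩
  have := he hxy
  exact Subtype.ext (ext fun j => DFunLike.congr_fun this j)

theorem isOpen_coset (a : Vilenkin p) (l : ℤ) : IsOpen {x | x - a ∈ U p l} :=
  (isOpen_U l).preimage (continuous_id.sub continuous_const)

/-- Every coset of `U_l` contains a sequence of finite support, so there are only countably many
cosets of the groups `U_l`. -/
instance instSecondCountableTopology [NeZero p] : SecondCountableTopology (Vilenkin p) := by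
  have hb : TopologicalSpace.IsTopologicalBasis
      ((fun q : Vilenkin p × ℤ => {x | x - q.1 ∈ U p q.2}) ''
        ({x : Vilenkin p | (Function.support fun j => x j).Finite} ×ˢ Set.univ)) := by
    refine TopologicalSpace.isTopologicalBasis_of_isOpen_of_nhds ?_ ?_
    · rintro _ ⟨⟨a, l⟩, -, rfl⟩
      exact isOpen_coset a l
    · intro x s hx hs
      obtain ⟨l, hl⟩ := mem_nhds_iff.1 (hs.mem_nhds hx)
      refine ⟨_, ⟨(trunc l x, l), ⟨finite_support_trunc l x, trivial⟩, rfl⟩,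
        sub_trunc_mem_U l x, fun y hy => hl y fun j hj => ?_⟩
      rw [sub_mem_U_iff.1 hy j hj, trunc_apply, if_pos hj]
  exact hb.secondCountableTopology
    ((countable_finite_support.prod Set.countable_univ).image _)

instance instLocallyCompactSpace [NeZero p] : LocallyCompactSpace (Vilenkin p) :=
  (isCompact_U 0).locallyCompactSpace_of_mem_nhds_of_addGroup
    ((isOpen_U 0).mem_nhds (x := 0) fun _ _ => rfl)

theorem finite_support_of_mem_H {x : Vilenkin p} (hx : x ∈ H p) :
    (Function.support fun j => x j).Finite := by
  obtain ⟨k, hk⟩ := x.2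
  refine (Set.finite_Icc k 0).subset fun j hj => ⟨?_, ?_⟩
  · by_contra h
    exact hj (hk j (not_le.1 h))
  · by_contra h
    exact hj (hx j (not_le.1 h))

instance instCountableH [NeZero p] : Countable (H p) :=
  (countable_finite_support.mono fun _ hx => finite_support_of_mem_H hx :
    {x | x ∈ H p}.Countable)

theorem annihilatorH_eq [NeZero p] : annihilatorH p = H p := by
  ext x
  exact mem_annihilatorH_iff

instance instCountableAnnihilatorH [NeZero p] : Countable (annihilatorH p) := by
  rw [annihilatorH_eq]
  infer_instance

/-! ### The pairing -/

section Character

variable [NeZero p]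

theorem character_comm (x ω : Vilenkin p) : character x ω = character ω x := by
  unfold character
  congr 1
  refine finsum_eq_of_bijective (fun j => 1 - j) (Equiv.subLeft (1 : ℤ)).bijective fun j => ?_
  rw [sub_sub_cancel, mul_comm]

theorem character_add_left (x y ω : Vilenkin p) :
    character (x + y) ω = character x ω * character y ω := by
  rw [character_comm, character_add_right, character_comm ω x, character_comm ω y]

theorem norm_character (x ω : Vilenkin p) : ‖character x ω‖ = 1 := by
  unfold character
  exact AddChar.norm_apply _ _

theorem character_neg_right (x ω : Vilenkin p) : character x (-ω) = conj (character x ω) := by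
  have h : (fun j : ℤ => x j * (-ω : Vilenkin p) (1 - j)) = fun j => -(x j * ω (1 - j)) := by
    ext j
    rw [neg_apply, mul_neg]
  rw [character, h, finsum_neg_distrib, AddChar.map_neg_eq_conj, character]

theorem character_neg_left (x ω : Vilenkin p) : character (-x) ω = conj (character x ω) := by
  rw [character_comm, character_neg_right, character_comm]

theorem character_eq_one {x ω : Vilenkin p} {l : ℤ} (hx : x ∈ U p (-l)) (hω : ω ∈ U p l) :
    character x ω = 1 := by
  have : ∀ i : ℤ, x i * ω (1 - i) = 0 := fun i => by
    rcases le_or_gt i (-l) with hi | hi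
    · exact mul_eq_zero_of_left (hx i hi) _
    · exact mul_eq_zero_of_right _ (hω _ (by omega))
  simp [character, this]

theorem character_single (x : Vilenkin p) (j : ℤ) :
    character x (single (1 - j) 1) = ZMod.stdAddChar (x j) := by
  rw [character, finsum_eq_single _ j fun i hi =>
    mul_eq_zero_of_right _ (single_of_ne (by omega) _), single_same, mul_one]

/-- The annihilator of `U_l` is no larger than `U_{-l}`. -/
theorem exists_character_ne_one {x : Vilenkin p} {l : ℤ} (hx : x ∉ U p (-l)) :
    ∃ ω ∈ U p l, character x ω ≠ 1 := by
  simp only [U, Set.mem_ofPred_eq, not_forall] at hx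
  obtain ⟨j, hj, hne⟩ := hx
  refine ⟨single (1 - j) 1, single_mem_U (by omega) 1, fun h => hne ?_⟩
  rw [character_single, ← AddChar.map_zero_eq_one (ZMod.stdAddChar (N := p))] at h
  exact ZMod.injective_stdAddChar h

theorem continuous_character :
    Continuous fun q : Vilenkin p × Vilenkin p => character q.1 q.2 := by
  refine IsLocallyConstant.continuous ((IsLocallyConstant.iff_eventually_eq _).2 ?_)
  rintro ⟨x, ω⟩
  obtain ⟨k, hk⟩ := x.2
  obtain ⟨l, hl⟩ := ω.2
  -- a change of `x` or `ω` inside `U_m` does not affect the entries that meet in the pairing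
  set m : ℤ := max (max k l) (max (1 - k) (1 - l)) with hm
  have h1 : ∀ᶠ y in nhds x, y - x ∈ U p m :=
    (isOpen_coset x m).mem_nhds (show x - x ∈ U p m by rw [sub_self]; exact fun _ _ => rfl)
  have h2 : ∀ᶠ y in nhds ω, y - ω ∈ U p m :=
    (isOpen_coset ω m).mem_nhds (show ω - ω ∈ U p m by rw [sub_self]; exact fun _ _ => rfl)
  rw [nhds_prod_eq]
  filter_upwards [h1.prod_mk h2] with ⟨y, ξ⟩ ⟨hy, hξ⟩
  rw [sub_mem_U_iff] at hy hξ
  simp only at hy hξ ⊢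
  unfold character
  congr 2
  ext i
  rcases le_or_gt i m with hi | hi
  · rw [hy i hi]
    rcases le_or_gt (1 - i) m with hi' | hi'
    · rw [hξ _ hi']
    · have : x i = 0 := hk i (by omega)
      rw [this, zero_mul, zero_mul]
  · rw [hξ (1 - i) (by omega)]
    have : ω (1 - i) = 0 := hl _ (by omega)
    rw [this, mul_zero, mul_zero]

theorem continuous_character_right (x : Vilenkin p) :
    Continuous fun ω : Vilenkin p => character x ω := by
  have h : Continuous fun ω : Vilenkin p => (x, ω) := by fun_prop
  have := continuous_character.comp' h
  exact this

theorem continuous_character_left (ω : Vilenkin p) :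
    Continuous fun x : Vilenkin p => character x ω := by
  have h : Continuous fun x : Vilenkin p => (x, ω) := by fun_prop
  have := continuous_character.comp' h
  exact this

end Character

/-! ### Haar measure of the subgroups `U_l` and integrals of characters over them -/

theorem H_inter_U_zero {x : Vilenkin p} (hx : x ∈ H p) (hU : x ∈ U p 0) : x = 0 :=
  ext fun j => (le_or_gt j 0).elim (hU j) (hx j)

section Haar

variable [NeZero p]

theorem haar_U_ne_top (l : ℤ) : haar p (U p l) ≠ ∞ := (isCompact_U l).measure_ne_top

/-- `U_l` is the disjoint union of `p` translates of `U_{l + 1}`. -/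
theorem haar_U_succ (l : ℤ) : haar p (U p l) = p * haar p (U p (l + 1)) := by
  have h : U p l = ⋃ a : ZMod p, (fun x => x - single (l + 1) a) ⁻¹' U p (l + 1) := by
    ext x
    simp only [Set.mem_iUnion, Set.mem_preimage]
    constructor
    · refine fun hx => ⟨x (l + 1), sub_mem_U_iff.2 fun j hj => ?_⟩
      rcases hj.eq_or_lt with rfl | hj
      · rw [single_same]
      · rw [single_of_ne hj.ne, hx j (by omega)]
    · rintro ⟨a, ha⟩ j hj
      rw [sub_mem_U_iff.1 ha j (by omega), single_of_ne (by omega)]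
  rw [h, measure_iUnion]
  · simp_rw [(measurePreserving_sub_right (haar p) _).measure_preimage
      (measurableSet_U (l + 1)).nullMeasurableSet]
    simp
  · intro a b hab
    refine Set.disjoint_left.2 fun x hxa hxb => hab ?_
    have ha := sub_mem_U_iff.1 hxa (l + 1) le_rfl
    have hb := sub_mem_U_iff.1 hxb (l + 1) le_rfl
    rw [single_same] at ha hb
    rw [← ha, hb]
  · exact fun a => (measurableSet_U _).preimage (measurable_id.sub_const _)

theorem haar_real_U (l : ℤ) : (haar p).real (U p l) = (p : ℝ) ^ (-l) := by
  have hp : (p : ℝ) ≠ 0 := Nat.cast_ne_zero.2 (NeZero.ne p)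
  have hs : ∀ l : ℤ, (haar p).real (U p l) = p * (haar p).real (U p (l + 1)) := fun l => by
    rw [Measure.real, haar_U_succ, ENNReal.toReal_mul, ENNReal.toReal_natCast, Measure.real]
  induction l using Int.induction_on with
  | zero => simp [Measure.real, haar_U_zero]
  | succ n ih =>
    rw [hs] at ih
    rw [neg_add, zpow_add₀ hp, ← ih, zpow_neg_one]
    field_simp
  | pred n ih =>
    rw [hs, sub_add_cancel, ih, neg_sub, sub_eq_add_neg, zpow_add₀ hp, zpow_one]

theorem haar_real_U_mul (l : ℤ) : (haar p).real (U p l) * (haar p).real (U p (-l)) = 1 := by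
  have hp : (p : ℝ) ≠ 0 := Nat.cast_ne_zero.2 (NeZero.ne p)
  rw [haar_real_U, haar_real_U, ← zpow_add₀ hp, add_neg_cancel, zpow_zero]

/-- A character that is trivial on `U_l` integrates to the measure of `U_l`, any other one to
zero, since translation by `ξ ∈ U_l` multiplies the integral by `χ(x, ξ)`. -/
theorem setIntegral_character (x : Vilenkin p) (l : ℤ) :
    ∫ ω in U p l, character x ω ∂(haar p) =
      (U p (-l)).indicator (fun _ => ((haar p).real (U p l) : ℂ)) x := by
  by_cases hx : x ∈ U p (-l)
  · rw [Set.indicator_of_mem hx, setIntegral_congr_fun (g := fun _ => (1 : ℂ))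
      (measurableSet_U l) fun ω hω => character_eq_one hx hω]
    simp
  · rw [Set.indicator_of_notMem hx]
    obtain ⟨ξ, hξ, hne⟩ := exists_character_ne_one hx
    have hmem : ∀ ω, ω + ξ ∈ U p l ↔ ω ∈ U p l := fun ω =>
      forall₂_congr fun j hj => by rw [add_apply, hξ j hj, add_zero]
    have h : ∫ ω in U p l, character x ω ∂(haar p) =
        character x ξ * ∫ ω in U p l, character x ω ∂(haar p) := by
      conv_lhs => rw [← integral_indicator (measurableSet_U l),
        ← integral_add_right_eq_self _ ξ]
      rw [← integral_indicator (measurableSet_U l), ← integral_const_mul]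
      congr 1 with ω
      by_cases hω : ω ∈ U p l
      · rw [Set.indicator_of_mem ((hmem ω).2 hω), Set.indicator_of_mem hω, character_add_right,
          mul_comm]
      · rw [Set.indicator_of_notMem (mt (hmem ω).1 hω), Set.indicator_of_notMem hω, mul_zero]
    by_contra h0
    exact hne (mul_right_cancel₀ h0 (by rw [one_mul]; exact h.symm))

open Classical in
/-- The characters of `U` given by distinct elements of `H` are orthonormal. -/
theorem setIntegral_character_sub (h k : H p) :
    ∫ ω in U p 0, character (h - k : Vilenkin p) ω ∂(haar p) = if h = k then 1 else 0 := by
  rw [setIntegral_character, neg_zero]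
  split_ifs with hk
  · rw [hk, sub_self, Set.indicator_of_mem (show (0 : Vilenkin p) ∈ U p 0 from fun _ _ => rfl),
      Measure.real, haar_U_zero]
    simp
  · refine Set.indicator_of_notMem (fun hU => hk ?_) _
    exact Subtype.ext (sub_eq_zero.1 (H_inter_U_zero ((H p).sub_mem h.2 k.2) hU))

end Haar

variable [NeZero p]

/-! ### Plancherel's theorem -/

theorem continuous_translate (f : L2 p) : Continuous fun h : Vilenkin p => translate h f := by
  have hc : Continuous fun q : Vilenkin p × Vilenkin p => q.2 - q.1 :=
    continuous_snd.sub continuous_fst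
  exact Continuous.compMeasurePreservingLp (p := 2) (f := fun _ : Vilenkin p => f)
    (g := fun h => (⟨_, hc⟩ : C(Vilenkin p × Vilenkin p, Vilenkin p)).curry h) continuous_const
    (ContinuousMap.continuous _) (fun h => measurePreserving_sub_right (haar p) h) (by simp)

theorem coeFn_translate (h : Vilenkin p) (f : L2 p) :
    translate h f =ᵐ[haar p] fun x => f (x - h) :=
  Lp.coeFn_compMeasurePreserving _ _

theorem translate_zero (f : L2 p) : translate 0 f = f := by
  refine Lp.ext ((coeFn_translate 0 f).trans ?_)
  simp only [sub_zero]
  rfl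

theorem lintegral_enorm_sq_eq_eLpNorm_sq (f : Vilenkin p → ℂ) :
    ∫⁻ x, ‖f x‖ₑ ^ 2 ∂(haar p) = eLpNorm f 2 (haar p) ^ 2 := by
  have := eLpNorm_nnreal_pow_eq_lintegral (f := f) (μ := haar p) (p := 2) two_ne_zero
  simpa using this.symm

theorem lintegral_enorm_sq_eq (f : L2 p) : ∫⁻ x, ‖f x‖ₑ ^ 2 ∂(haar p) = ‖f‖ₑ ^ 2 := by
  rw [lintegral_enorm_sq_eq_eLpNorm_sq, Lp.enorm_def]

/-- The autocorrelation `t ↦ ∫ f(x) conj f(x ⊖ t) dμ(x)` of `f`. -/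
noncomputable def autocorrelation (f : L2 p) (t : Vilenkin p) : ℂ := ⟪translate t f, f⟫_ℂ

theorem continuous_autocorrelation (f : L2 p) : Continuous (autocorrelation f) :=
  (continuous_translate f).inner continuous_const

theorem autocorrelation_zero (f : L2 p) : autocorrelation f 0 = (‖f‖ : ℂ) ^ 2 := by
  rw [autocorrelation, translate_zero, inner_self_eq_norm_sq_to_K]
  rfl

theorem autocorrelation_eq (f : L2 p) (t : Vilenkin p) :
    autocorrelation f t = ∫ x, f x * conj (f (x - t)) ∂(haar p) := by
  rw [autocorrelation, L2.inner_def]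
  refine integral_congr_ae ?_
  filter_upwards [coeFn_translate t f] with x hx
  rw [hx, RCLike.inner_apply]

section Fubini

variable {f : L2 p} (hf : Integrable f (haar p))
include hf

theorem integrable_mul_character (ω : Vilenkin p) :
    Integrable (fun x => f x * conj (character x ω)) (haar p) := by
  refine hf.mul_bdd (c := 1) ?_ (Filter.Eventually.of_forall fun x => ?_)
  · exact (Complex.continuous_conj.comp (continuous_character_left ω)).aestronglyMeasurable
  · rw [RCLike.norm_conj, norm_character]

theorem continuous_fourierIntegral : Continuous (fourierIntegral f) := by
  refine continuous_of_dominated (bound := fun x => ‖f x‖)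
    (fun ω => (integrable_mul_character hf ω).aestronglyMeasurable)
    (fun ω => Filter.Eventually.of_forall fun x => ?_) hf.norm
    (Filter.Eventually.of_forall fun x => ?_)
  · rw [norm_mul, RCLike.norm_conj, norm_character, mul_one]
  · have := Complex.continuous_conj.comp (continuous_character_right x)
    exact continuous_const.mul this

theorem integrable_autocorrelation_integrand :
    Integrable (fun q : Vilenkin p × Vilenkin p => f q.2 * conj (f (q.2 - q.1)))
      ((haar p).prod (haar p)) := by
  -- the integrand is that of the convolution of `f` with `x ↦ conj f(⊖x)`
  have hg : Integrable (fun x => conj (f (-x))) (haar p) := by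
    have h1 := hf.comp_neg
    exact (Complex.conjLIE.toContinuousLinearEquiv.toContinuousLinearMap.integrable_comp h1 :)
  have := hf.convolution_integrand (ContinuousLinearMap.mul ℝ ℂ) hg
  simpa using this

theorem integrable_autocorrelation : Integrable (autocorrelation f) (haar p) := by
  have := (integrable_autocorrelation_integrand hf).integral_prod_left
  exact this.congr (Filter.Eventually.of_forall fun t => (autocorrelation_eq f t).symm)

/-- The Fourier transform of the autocorrelation of `f` is `|f̂|²`. -/
theorem fourierIntegral_autocorrelation (ω : Vilenkin p) :
    fourierIntegral (autocorrelation f) ω = (‖fourierIntegral f ω‖ : ℂ) ^ 2 := by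
  have hint : Integrable (Function.uncurry fun t x : Vilenkin p =>
      f x * conj (f (x - t)) * conj (character t ω)) ((haar p).prod (haar p)) := by
    refine (integrable_autocorrelation_integrand hf).mul_bdd (c := 1) ?_
      (Filter.Eventually.of_forall fun q => ?_)
    · have := (continuous_character_left ω).comp
        (continuous_fst : Continuous (Prod.fst : Vilenkin p × Vilenkin p → Vilenkin p))
      exact (Complex.continuous_conj.comp this).aestronglyMeasurable
    · rw [RCLike.norm_conj, norm_character]
  have hinner : ∀ x : Vilenkin p,
      ∫ t, f x * conj (f (x - t)) * conj (character t ω) ∂(haar p) =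
        f x * conj (character x ω) * conj (fourierIntegral f ω) := fun x => by
    rw [← integral_sub_left_eq_self _ (haar p) x, fourierIntegral, ← integral_conj,
      ← integral_const_mul]
    congr 1 with t
    rw [sub_sub_cancel, sub_eq_add_neg, character_add_left, character_neg_left]
    simp only [map_mul, Complex.conj_conj]
    ring
  calc fourierIntegral (autocorrelation f) ω
      = ∫ t, ∫ x, f x * conj (f (x - t)) * conj (character t ω) ∂(haar p) ∂(haar p) := by
        unfold fourierIntegral
        congr 1 with t
        rw [autocorrelation_eq, integral_mul_const]
    _ = ∫ x, f x * conj (character x ω) * conj (fourierIntegral f ω) ∂(haar p) := by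
        rw [integral_integral_swap hint]
        simp_rw [hinner]
    _ = (‖fourierIntegral f ω‖ : ℂ) ^ 2 := by
        rw [integral_mul_const, ← fourierIntegral, Complex.mul_conj, Complex.normSq_eq_norm_sq]
        push_cast
        rfl

end Fubini

/-- The integral of a Fourier transform over `U_l` is an average over the annihilator `U_{-l}`. -/
theorem setIntegral_fourierIntegral {g : Vilenkin p → ℂ} (hg : Integrable g (haar p)) (l : ℤ) :
    ∫ ω in U p l, fourierIntegral g ω ∂(haar p) =
      (haar p).real (U p l) * ∫ t in U p (-l), g t ∂(haar p) := by
  have : IsFiniteMeasure ((haar p).restrict (U p l)) :=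
    isFiniteMeasure_restrict.2 (haar_U_ne_top l)
  have hint : Integrable (Function.uncurry fun ω t : Vilenkin p => g t * conj (character t ω))
      (((haar p).restrict (U p l)).prod (haar p)) := by
    refine (hg.comp_snd _).mul_bdd (c := 1) ?_ (Filter.Eventually.of_forall fun q => ?_)
    · have := (continuous_character (p := p)).comp continuous_swap
      exact (Complex.continuous_conj.comp this).aestronglyMeasurable
    · rw [RCLike.norm_conj, norm_character]
  unfold fourierIntegral
  rw [integral_integral_swap hint, ← integral_indicator (measurableSet_U (-l)),
    ← integral_const_mul]
  congr 1 with t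
  rw [integral_const_mul, integral_conj, setIntegral_character]
  by_cases ht : t ∈ U p (-l)
  · rw [Set.indicator_of_mem ht, Set.indicator_of_mem ht, Complex.conj_ofReal, mul_comm]
  · rw [Set.indicator_of_notMem ht, Set.indicator_of_notMem ht, map_zero, mul_zero, mul_zero]

theorem integrableOn_U {E : Type*} [NormedAddCommGroup E] {g : Vilenkin p → E}
    (hg : Continuous g) (l : ℤ) : IntegrableOn g (U p l) (haar p) :=
  hg.continuousOn.integrableOn_compact' (isCompact_U l) (measurableSet_U l)

/-- The averages of a continuous function over the groups `U_n` converge to its value at zero. -/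
theorem tendsto_average_U {g : Vilenkin p → ℂ} (hg : Continuous g) :
    Filter.Tendsto (fun n : ℕ => ((haar p).real (U p (-n)) : ℂ) * ∫ t in U p n, g t ∂(haar p))
      Filter.atTop (nhds (g 0)) := by
  rw [Metric.tendsto_atTop]
  intro ε hε
  obtain ⟨l, hl⟩ := mem_nhds_iff.1 (hg.continuousAt (Metric.ball_mem_nhds (g 0) (half_pos hε)))
  refine ⟨l.toNat, fun n hn => ?_⟩
  have hsub : ∀ t ∈ U p n, ‖g t - g 0‖ ≤ ε / 2 := fun t ht => by
    have : t ∈ g ⁻¹' Metric.ball (g 0) (ε / 2) := hl t fun j hj => ht j (by omega)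
    rw [Set.mem_preimage, Metric.mem_ball, dist_eq_norm] at this
    exact this.le
  have hmul := haar_real_U_mul (p := p) n
  have heq : ((haar p).real (U p (-n)) : ℂ) * ∫ t in U p n, g t ∂(haar p) - g 0 =
      (haar p).real (U p (-n)) * ∫ t in U p n, (g t - g 0) ∂(haar p) := by
    rw [integral_sub (integrableOn_U hg _) (integrableOn_U continuous_const _),
      setIntegral_const, mul_sub, Complex.real_smul,
      ← mul_assoc, ← Complex.ofReal_mul, mul_comm ((haar p).real (U p (-n))), hmul,
      Complex.ofReal_one, one_mul]
  rw [dist_eq_norm, heq, norm_mul, Complex.norm_real, Real.norm_of_nonneg measureReal_nonneg]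
  calc (haar p).real (U p (-n)) * ‖∫ t in U p n, (g t - g 0) ∂(haar p)‖
      ≤ (haar p).real (U p (-n)) * (ε / 2 * (haar p).real (U p n)) := by
        gcongr
        exact norm_setIntegral_le_of_norm_le_const (haar_U_ne_top _).lt_top hsub
    _ = ε / 2 * ((haar p).real (U p n) * (haar p).real (U p (-n))) := by ring
    _ < ε := by rw [hmul, mul_one]; exact half_lt_self hε

theorem aecover_U : AECover (haar p) Filter.atTop fun n : ℕ => U p (-n) where
  ae_eventually_mem := Filter.Eventually.of_forall fun x => by
    obtain ⟨k, hk⟩ := x.2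
    filter_upwards [Filter.eventually_ge_atTop (1 - k).toNat] with n hn j hj
    exact hk j (by omega)
  measurableSet n := measurableSet_U _

/-- Plancherel's identity: the integrals of `|f̂|²` over the groups `U_{-n}`, which exhaust the
dual group, are averages of the autocorrelation of `f` over `U_n` and converge to its value
`‖f‖²` at zero. -/
theorem lintegral_enorm_fourierIntegral {f : L2 p} (hf : Integrable f (haar p)) :
    ∫⁻ ω, ‖fourierIntegral f ω‖ₑ ^ 2 ∂(haar p) = ‖f‖ₑ ^ 2 := by
  have hc := continuous_fourierIntegral hf
  refine aecover_U.lintegral_eq_of_tendsto _ (hc.enorm.measurable.pow_const 2).aemeasurable ?_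
  have hn : ∀ n : ℕ, ∫⁻ ω in U p (-n), ‖fourierIntegral f ω‖ₑ ^ 2 ∂(haar p) =
      ENNReal.ofReal (((haar p).real (U p (-n)) : ℂ) *
        ∫ t in U p n, autocorrelation f t ∂(haar p)).re := fun n => by
    have h1 := setIntegral_fourierIntegral (integrable_autocorrelation hf) (-n)
    rw [neg_neg] at h1
    rw [← h1]
    simp_rw [fourierIntegral_autocorrelation hf, ← Complex.ofReal_pow]
    rw [integral_complex_ofReal, Complex.ofReal_re, ofReal_integral_eq_lintegral_ofReal]
    · simp_rw [ENNReal.ofReal_pow (norm_nonneg _), ofReal_norm]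
    · exact integrableOn_U (hc.norm.pow 2) _
    · exact Filter.Eventually.of_forall fun _ => by positivity
  simp_rw [hn]
  have h2 := tendsto_average_U (continuous_autocorrelation f)
  have h3 := ENNReal.tendsto_ofReal ((Complex.continuous_re.tendsto _).comp h2)
  rw [autocorrelation_zero, ← Complex.ofReal_pow, Complex.ofReal_re,
    ENNReal.ofReal_pow (norm_nonneg _), ofReal_norm] at h3
  exact h3

theorem memLp_fourierIntegral {f : L2 p} (hf : Integrable f (haar p)) :
    MemLp (fourierIntegral f) 2 (haar p) := by
  refine ⟨(continuous_fourierIntegral hf).aestronglyMeasurable, ?_⟩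
  have h := lintegral_enorm_fourierIntegral hf
  rw [lintegral_enorm_sq_eq_eLpNorm_sq] at h
  rw [(ENNReal.pow_right_strictMono two_ne_zero).injective h]
  exact enorm_lt_top

theorem coeFn_fourierOnL1L2 {f : L2 p} (hf : Integrable f (haar p)) :
    fourierOnL1L2 f =ᵐ[haar p] fourierIntegral f := by
  rw [fourierOnL1L2, dif_pos (memLp_fourierIntegral hf)]
  exact MemLp.coeFn_toLp _

theorem norm_fourierOnL1L2 {f : L2 p} (hf : Integrable f (haar p)) :
    ‖fourierOnL1L2 f‖ = ‖f‖ := by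
  have h : ‖fourierOnL1L2 f‖ₑ ^ 2 = ‖f‖ₑ ^ 2 := by
    rw [← lintegral_enorm_sq_eq, ← lintegral_enorm_fourierIntegral hf]
    refine lintegral_congr_ae ?_
    filter_upwards [coeFn_fourierOnL1L2 hf] with ω hω
    rw [hω]
  have := (ENNReal.pow_right_strictMono two_ne_zero).injective h
  rw [← toReal_enorm, ← toReal_enorm, this]

/-! ### The Fourier transform on `L²` -/

/-- The subspace `L¹(G) ∩ L²(G)` of `L²(G)`. -/
def integrableSubmodule (p : ℕ) [NeZero p] : Submodule ℂ (L2 p) where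
  carrier := {g | Integrable g (haar p)}
  zero_mem' := (integrable_zero _ _ _).congr (Lp.coeFn_zero _ _ _).symm
  add_mem' {f g} hf hg := (Integrable.add hf hg).congr (Lp.coeFn_add f g).symm
  smul_mem' c f hf := (Integrable.smul c hf).congr (Lp.coeFn_smul c f).symm

theorem dense_integrableSubmodule : Dense (integrableSubmodule p : Set (L2 p)) := by
  refine (Lp.simpleFunc.dense (E := ℂ) (μ := haar p) (p := 2) (by simp)).mono fun f hf => ?_
  have h : MemLp (Lp.simpleFunc.toSimpleFunc ⟨f, hf⟩) 2 (haar p) :=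
    Lp.simpleFunc.memLp ⟨f, hf⟩
  exact ((SimpleFunc.memLp_iff_integrable two_ne_zero (by simp)).1 h).congr
    (Lp.simpleFunc.toSimpleFunc_eq_toFun ⟨f, hf⟩)

/-- The Fourier integral as a linear map on `L¹(G) ∩ L²(G)`. -/
noncomputable def fourierLinearMap (p : ℕ) [NeZero p] : integrableSubmodule p →ₗ[ℂ] L2 p where
  toFun f := fourierOnL1L2 (f : L2 p)
  map_add' f g := by
    refine Lp.ext ?_
    filter_upwards [coeFn_fourierOnL1L2 (f + g).2, coeFn_fourierOnL1L2 f.2,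
      coeFn_fourierOnL1L2 g.2, Lp.coeFn_add (fourierOnL1L2 (f : L2 p)) (fourierOnL1L2 (g : L2 p))]
      with ω h1 h2 h3 h4
    rw [h1, h4, Pi.add_apply, h2, h3]
    unfold fourierIntegral
    rw [← integral_add (integrable_mul_character f.2 ω) (integrable_mul_character g.2 ω)]
    refine integral_congr_ae ?_
    filter_upwards [Lp.coeFn_add (f : L2 p) (g : L2 p)] with x hx
    rw [Submodule.coe_add, hx, Pi.add_apply, add_mul]
  map_smul' c f := by
    refine Lp.ext ?_
    filter_upwards [coeFn_fourierOnL1L2 (c • f).2, coeFn_fourierOnL1L2 f.2,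
      Lp.coeFn_smul c (fourierOnL1L2 (f : L2 p))] with ω h1 h2 h3
    rw [h1, RingHom.id_apply, h3, Pi.smul_apply, h2]
    unfold fourierIntegral
    rw [← integral_smul]
    refine integral_congr_ae ?_
    filter_upwards [Lp.coeFn_smul c (f : L2 p)] with x hx
    rw [Submodule.coe_smul, hx, Pi.smul_apply, smul_mul_assoc]

theorem denseRange_subtype : DenseRange (integrableSubmodule p).subtype := by
  rw [DenseRange, Submodule.coe_subtype, Subtype.range_coe]
  exact dense_integrableSubmodule

/-- The continuous linear extension of the Fourier integral from `L¹(G) ∩ L²(G)` to `L²(G)`. -/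
noncomputable def fourierCLM (p : ℕ) [NeZero p] : L2 p →L[ℂ] L2 p :=
  (fourierLinearMap p).extendOfNorm (integrableSubmodule p).subtype

theorem fourierCLM_eq {f : L2 p} (hf : Integrable f (haar p)) :
    fourierCLM p f = fourierOnL1L2 f :=
  LinearMap.extendOfNorm_eq denseRange_subtype
    ⟨1, fun g => by rw [one_mul]; exact (norm_fourierOnL1L2 g.2).le⟩
    (⟨f, hf⟩ : integrableSubmodule p)

theorem fourier_eq (f : L2 p) : fourier f = fourierCLM p f := by
  refine extendFrom_eq (dense_integrableSubmodule f) ?_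
  refine ((fourierCLM p).continuous.tendsto f |>.mono_left nhdsWithin_le_nhds).congr' ?_
  filter_upwards [self_mem_nhdsWithin] with g hg using fourierCLM_eq hg

theorem norm_fourierCLM (f : L2 p) : ‖fourierCLM p f‖ = ‖f‖ := by
  refine dense_integrableSubmodule.induction (P := fun f => ‖fourierCLM p f‖ = ‖f‖)
    (fun g hg => ?_) (isClosed_eq (fourierCLM p).continuous.norm continuous_norm) f
  rw [fourierCLM_eq hg, norm_fourierOnL1L2 hg]

theorem memLp_modulate (h : Vilenkin p) (f : L2 p) :
    MemLp (fun ω => conj (character h ω) * f ω) 2 (haar p) := by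
  refine (Lp.memLp f).of_le ?_ (Filter.Eventually.of_forall fun ω => ?_)
  · have := Complex.continuous_conj.comp (continuous_character_right h)
    exact this.aestronglyMeasurable.mul (Lp.aestronglyMeasurable f)
  · rw [norm_mul, RCLike.norm_conj, norm_character, one_mul]

/-- Multiplication by the conjugate of the character `χ(h, ·)` on `L²(G*)`. -/
noncomputable def modulate (h : Vilenkin p) (f : L2 p) : L2 p := (memLp_modulate h f).toLp

theorem coeFn_modulate (h : Vilenkin p) (f : L2 p) :
    modulate h f =ᵐ[haar p] fun ω => conj (character h ω) * f ω :=
  MemLp.coeFn_toLp _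

theorem isometry_modulate (h : Vilenkin p) : Isometry (modulate (p := p) h) := fun f g => by
  rw [modulate, modulate, Lp.edist_toLp_toLp, Lp.edist_def]
  refine eLpNorm_congr_norm_ae (Filter.Eventually.of_forall fun ω => ?_)
  simp only [Pi.sub_apply]
  rw [← mul_sub, norm_mul, RCLike.norm_conj, norm_character, one_mul]

theorem isometry_translate (h : Vilenkin p) : Isometry (translate (p := p) h) :=
  Lp.isometry_compMeasurePreserving _

theorem integrable_translate (h : Vilenkin p) {f : L2 p} (hf : Integrable f (haar p)) :
    Integrable (translate h f) (haar p) :=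
  (hf.comp_sub_right h).congr (coeFn_translate h f).symm

theorem fourierIntegral_translate (h : Vilenkin p) (f : L2 p) (ω : Vilenkin p) :
    fourierIntegral (translate h f) ω = conj (character h ω) * fourierIntegral f ω := by
  have h1 : fourierIntegral (translate h f) ω =
      ∫ x, f (x - h) * conj (character x ω) ∂(haar p) := by
    refine integral_congr_ae ?_
    filter_upwards [coeFn_translate h f] with x hx
    rw [hx]
  rw [h1, ← integral_add_right_eq_self _ h, fourierIntegral, ← integral_const_mul]
  congr 1 with x
  rw [add_sub_cancel_right, character_add_left, map_mul]
  ring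

/-- The Fourier transform intertwines translations and multiplication by characters. -/
theorem fourierCLM_translate (h : Vilenkin p) (f : L2 p) :
    fourierCLM p (translate h f) = modulate h (fourierCLM p f) := by
  refine dense_integrableSubmodule.induction
    (P := fun f => fourierCLM p (translate h f) = modulate h (fourierCLM p f))
    (fun g hg => ?_) (isClosed_eq ((fourierCLM p).continuous.comp (isometry_translate h).continuous)
      ((isometry_modulate h).continuous.comp (fourierCLM p).continuous)) f
  have hT := integrable_translate h hg
  rw [fourierCLM_eq hT, fourierCLM_eq hg]
  refine Lp.ext ?_
  filter_upwards [coeFn_fourierOnL1L2 hT, coeFn_fourierOnL1L2 hg,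
    coeFn_modulate h (fourierOnL1L2 g)] with ω h1 h2 h3
  rw [h1, h3, h2, fourierIntegral_translate]

end Vilenkin

/-! ### Bessel families in a Hilbert space -/

section Bessel

variable {ι E : Type*} [NormedAddCommGroup E] [InnerProductSpace ℂ E]

theorem lp_two_norm_sq (c : lp (fun _ : ι => ℂ) 2) : ‖c‖ ^ 2 = ∑' j, ‖c j‖ ^ 2 := by
  have := lp.norm_rpow_eq_tsum (p := 2) (by simp) c
  simpa using this

/-- The synthesis operator of a Bessel family is the adjoint of its analysis operator
`g ↦ (⟨f_j, g⟩)_j`. -/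
theorem IsBesselWithBound.exists_isSynthesisOperator [CompleteSpace E] {f : ι → E} {D : ℝ}
    (h : IsBesselWithBound f D) :
    ∃ T : lp (fun _ : ι => ℂ) 2 →L[ℂ] E, IsSynthesisOperator f T ∧ ‖T‖ ≤ √D := by
  classical
  obtain ⟨hD, hB⟩ := h
  have hmem : ∀ g, Memℓp (fun j => ⟪f j, g⟫_ℂ) 2 := fun g =>
    memℓp_gen (by simpa using (hB g).1)
  let A₀ : E →ₗ[ℂ] lp (fun _ : ι => ℂ) 2 :=
    { toFun := fun g => ⟨_, hmem g⟩
      map_add' := fun g g' => by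
        ext j
        exact inner_add_right _ _ _
      map_smul' := fun c g => by
        ext j
        exact inner_smul_right _ _ _ }
  have hA₀ : ∀ g, ‖A₀ g‖ ≤ √D * ‖g‖ := fun g => by
    refine le_of_sq_le_sq ?_ (by positivity)
    rw [mul_pow, Real.sq_sqrt hD.le, lp_two_norm_sq]
    exact (hB g).2
  let A : E →L[ℂ] lp (fun _ : ι => ℂ) 2 := A₀.mkContinuous (√D) hA₀
  have hT : ∀ (j : ι) (a : ℂ), A.adjoint (lp.single 2 j a) = a • f j := fun j a => by
    refine ext_inner_right ℂ fun g => ?_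
    rw [ContinuousLinearMap.adjoint_inner_left, lp.inner_single_left, inner_smul_left,
      RCLike.inner_apply, mul_comm]
    rfl
  refine ⟨A.adjoint, fun c => ?_, ?_⟩
  · have := A.adjoint.hasSum (lp.hasSum_single (by simp) c)
    simpa only [hT] using this
  · rw [LinearIsometryEquiv.norm_map]
    exact A₀.mkContinuous_norm_le (Real.sqrt_nonneg D) hA₀

theorem IsSynthesisOperator.norm_sum_sq_le {f : ι → E} {D : ℝ} (hD : 0 < D)
    {T : lp (fun _ : ι => ℂ) 2 →L[ℂ] E} (hT : IsSynthesisOperator f T) (hle : ‖T‖ ≤ √D)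
    (s : Finset ι) (c : ι → ℂ) : ‖∑ j ∈ s, c j • f j‖ ^ 2 ≤ D * ∑ j ∈ s, ‖c j‖ ^ 2 := by
  classical
  have hs : ∀ j, T (lp.single 2 j (c j)) = c j • f j := fun j => by
    refine (hT _).unique ?_
    convert! hasSum_single (f := fun i => (lp.single 2 j (c j) : lp (fun _ : ι => ℂ) 2) i • f i) j
      fun i hi => ?_ using 1
    · rw [lp.single_apply_self]
    · rw [lp.single_apply_ne _ _ _ hi, zero_smul]
  have hn : ‖∑ j ∈ s, lp.single 2 j (c j)‖ ^ 2 = ∑ j ∈ s, ‖c j‖ ^ 2 := by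
    have := lp.norm_sum_single (p := 2) (by simp) c s
    simpa using this
  rw [← hn, ← Real.sq_sqrt hD.le, ← mul_pow]
  refine pow_le_pow_left₀ (norm_nonneg _) ?_ 2
  simp_rw [← hs, ← map_sum]
  exact (T.le_opNorm _).trans (by gcongr)

/-- Testing the inequality against `c_j = ⟨f_j, g⟩` gives the Bessel inequality, by
Cauchy–Schwarz. -/
theorem isBesselWithBound_of_norm_sum_sq_le {f : ι → E} {D : ℝ} (hD : 0 < D)
    (h : ∀ (s : Finset ι) (c : ι → ℂ), ‖∑ j ∈ s, c j • f j‖ ^ 2 ≤ D * ∑ j ∈ s, ‖c j‖ ^ 2) :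
    IsBesselWithBound f D := by
  have hfin : ∀ (g : E) (s : Finset ι), ∑ j ∈ s, ‖⟪f j, g⟫_ℂ‖ ^ 2 ≤ D * ‖g‖ ^ 2 := fun g s => by
    set S := ∑ j ∈ s, ‖⟪f j, g⟫_ℂ‖ ^ 2 with hS
    have hS0 : 0 ≤ S := Finset.sum_nonneg fun _ _ => by positivity
    have h1 : ⟪∑ j ∈ s, ⟪f j, g⟫_ℂ • f j, g⟫_ℂ = S := by
      rw [sum_inner, hS]
      push_cast
      refine Finset.sum_congr rfl fun j _ => ?_
      rw [inner_smul_left, mul_comm, Complex.mul_conj, Complex.normSq_eq_norm_sq]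
      push_cast
      rfl
    have h2 : S ≤ ‖∑ j ∈ s, ⟪f j, g⟫_ℂ • f j‖ * ‖g‖ := by
      have := norm_inner_le_norm (𝕜 := ℂ) (∑ j ∈ s, ⟪f j, g⟫_ℂ • f j) g
      rwa [h1, Complex.norm_real, Real.norm_of_nonneg hS0] at this
    have h3 : S * S ≤ D * ‖g‖ ^ 2 * S := by
      calc S * S = S ^ 2 := (sq S).symm
        _ ≤ (‖∑ j ∈ s, ⟪f j, g⟫_ℂ • f j‖ * ‖g‖) ^ 2 := pow_le_pow_left₀ hS0 h2 2
        _ = ‖∑ j ∈ s, ⟪f j, g⟫_ℂ • f j‖ ^ 2 * ‖g‖ ^ 2 := mul_pow _ _ _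
        _ ≤ D * S * ‖g‖ ^ 2 := by gcongr; exact h s _
        _ = D * ‖g‖ ^ 2 * S := by ring
    rcases hS0.eq_or_lt with h0 | h0
    · rw [← h0]; positivity
    · exact le_of_mul_le_mul_right h3 h0
  refine ⟨hD, fun g => ?_⟩
  have hs := summable_of_sum_le (fun _ => by positivity) (hfin g)
  exact ⟨hs, hs.tsum_le_of_sum_le (hfin g)⟩

end Bessel

namespace Vilenkin

variable {p : ℕ} [NeZero p]

/-! ### Periodization over `H^⊥` -/

/-- `U` is a fundamental domain for the translations by `H^⊥`. -/
theorem isAddFundamentalDomain_U :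
    IsAddFundamentalDomain (annihilatorH p) (U p 0) (haar p) := by
  refine IsAddFundamentalDomain.mk' (measurableSet_U 0).nullMeasurableSet fun x => ?_
  -- the unique element of `H^⊥` that moves `x` into `U` cancels its entries at indices `j ≤ 0`
  have h0 : -trunc 0 x ∈ annihilatorH p := mem_annihilatorH_iff.2 fun j hj => by
    rw [neg_apply, trunc_apply, if_neg (by omega), neg_zero]
  refine ⟨⟨_, h0⟩, fun j hj => ?_, fun g hg => Subtype.ext (ext fun j => ?_)⟩
  · change (-trunc 0 x + x) j = 0
    rw [add_apply, neg_apply, trunc_apply, if_pos hj, neg_add_cancel]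
  · change (g : Vilenkin p) j = (-trunc 0 x) j
    rw [neg_apply, trunc_apply]
    split_ifs with hj
    · have : (g + x : Vilenkin p) j = 0 := hg j hj
      exact eq_neg_of_add_eq_zero_left this
    · rw [neg_zero]
      exact mem_annihilatorH_iff.1 g.2 j (by omega)

/-- The bracket `[F, F]` as a function with values in `[0, ∞]`, which is defined everywhere. -/
noncomputable def ebracket (F : Vilenkin p → ℂ) (ω : Vilenkin p) : ℝ≥0∞ :=
  ∑' h : annihilatorH p, ‖F (ω + h)‖ₑ ^ 2

theorem measurable_ebracket {F : Vilenkin p → ℂ} (hF : Measurable F) : Measurable (ebracket F) :=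
  Measurable.tsum fun h =>
    (hF.comp (measurable_id.add_const (h : Vilenkin p))).enorm.pow_const 2

theorem lintegral_eq_setLIntegral_tsum {g : Vilenkin p → ℝ≥0∞} (hg : Measurable g) :
    ∫⁻ ω, g ω ∂(haar p) = ∫⁻ ω in U p 0, ∑' h : annihilatorH p, g (ω + h) ∂(haar p) := by
  rw [isAddFundamentalDomain_U.lintegral_eq_tsum'' g, lintegral_tsum
    (f := fun (h : annihilatorH p) (ω : Vilenkin p) => g (ω + h)) fun h =>
      (hg.comp (measurable_id.add_const (h : Vilenkin p))).aemeasurable]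
  refine tsum_congr fun h => lintegral_congr fun ω => ?_
  rw [AddSubgroup.vadd_def, vadd_eq_add, add_comm]

theorem summable_iff_ebracket_ne_top {F : Vilenkin p → ℂ} {ω : Vilenkin p} :
    (Summable fun h : annihilatorH p => ‖F (ω + h)‖ ^ 2) ↔ ebracket F ω ≠ ∞ := by
  have h : ebracket F ω = ∑' h : annihilatorH p, ENNReal.ofReal (‖F (ω + h)‖ ^ 2) :=
    tsum_congr fun h => by rw [ENNReal.ofReal_pow (norm_nonneg _), ofReal_norm]
  rw [h]
  refine ⟨fun hs => hs.tsum_ofReal_ne_top, fun ht => ?_⟩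
  have := ENNReal.summable_toReal ht
  simpa [ENNReal.toReal_ofReal, sq_nonneg] using this

theorem bracket_self_le_iff {F : Vilenkin p → ℂ} {ω : Vilenkin p} {D : ℝ} (hD : 0 ≤ D)
    (hs : Summable fun h : annihilatorH p => ‖F (ω + h)‖ ^ 2) :
    bracket F F ω ≤ (D : ℂ) ↔ ebracket F ω ≤ ENNReal.ofReal D := by
  have h1 : bracket F F ω = (∑' h : annihilatorH p, ‖F (ω + h)‖ ^ 2 : ℝ) := by
    rw [bracket, Complex.ofReal_tsum]
    refine tsum_congr fun h => ?_
    rw [Complex.mul_conj, Complex.normSq_eq_norm_sq]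
  have h2 : ebracket F ω = ENNReal.ofReal (∑' h : annihilatorH p, ‖F (ω + h)‖ ^ 2) := by
    rw [ENNReal.ofReal_tsum_of_nonneg (fun _ => by positivity) hs]
    exact tsum_congr fun h => by rw [ENNReal.ofReal_pow (norm_nonneg _), ofReal_norm]
  rw [h1, h2, Complex.real_le_real, ENNReal.ofReal_le_ofReal_iff hD]

theorem ae_ebracket_ne_top (F : L2 p) :
    ∀ᵐ ω ∂(haar p).restrict (U p 0), ebracket F ω ≠ ∞ := by
  have hF := (Lp.stronglyMeasurable F).measurable
  have h : ∫⁻ ω in U p 0, ebracket F ω ∂(haar p) ≠ ∞ := by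
    unfold ebracket
    rw [← lintegral_eq_setLIntegral_tsum (hF.enorm.pow_const 2), lintegral_enorm_sq_eq]
    exact ENNReal.pow_ne_top enorm_ne_top
  filter_upwards [ae_lt_top (measurable_ebracket hF) h] with ω hω using hω.ne

/-! ### Trigonometric polynomials -/

/-- The polynomial `∑ c_h conj χ(h, ·)`, the Fourier-side multiplier of `∑ c_h T_h`. -/
noncomputable def trigPoly (s : Finset (H p)) (c : H p → ℂ) (ω : Vilenkin p) : ℂ :=
  ∑ h ∈ s, c h * conj (character (h : Vilenkin p) ω)

theorem continuous_trigPoly (s : Finset (H p)) (c : H p → ℂ) : Continuous (trigPoly s c) :=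
  continuous_finsetSum _ fun h _ => by
    have := Complex.continuous_conj.comp (continuous_character_right (h : Vilenkin p))
    exact continuous_const.mul this

theorem trigPoly_add (s : Finset (H p)) (c : H p → ℂ) (ω : Vilenkin p) (k : annihilatorH p) :
    trigPoly s c (ω + k) = trigPoly s c ω :=
  Finset.sum_congr rfl fun h _ => by rw [character_add_right, k.2 h h.2, mul_one]

/-- The norm of `∑ c_h T_h φ` on the Fourier side: the trigonometric polynomial is
`H^⊥`-periodic, so that periodization leaves the bracket as the weight. -/
theorem enorm_sum_translate_sq (φ : L2 p) (s : Finset (H p)) (c : H p → ℂ) :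
    ‖∑ h ∈ s, c h • translate (h : Vilenkin p) φ‖ₑ ^ 2 =
      ∫⁻ ω in U p 0, ‖trigPoly s c ω‖ₑ ^ 2 * ebracket (fourier φ) ω ∂(haar p) := by
  rw [fourier_eq]
  set F := fourierCLM p φ with hFdef
  have hF := (Lp.stronglyMeasurable F).measurable
  have hm := (continuous_trigPoly s c).measurable
  have hn : ‖∑ h ∈ s, c h • translate (h : Vilenkin p) φ‖ₑ =
      ‖∑ h ∈ s, c h • modulate (h : Vilenkin p) F‖ₑ := by
    rw [← ofReal_norm, ← ofReal_norm, ← norm_fourierCLM, map_sum]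
    simp_rw [map_smul, fourierCLM_translate]
    rfl
  have hae : ∀ᵐ ω ∂(haar p), (∑ h ∈ s, c h • modulate (h : Vilenkin p) F : L2 p) ω =
      trigPoly s c ω * F ω := by
    have h1 : ∀ᵐ ω ∂(haar p), ∀ h : H p,
        (c h • modulate (h : Vilenkin p) F : L2 p) ω = c h * (conj (character h ω) * F ω) := by
      refine ae_all_iff.2 fun h => ?_
      filter_upwards [Lp.coeFn_smul (c h) (modulate (h : Vilenkin p) F), coeFn_modulate h F]
        with ω h1 h2
      rw [h1, Pi.smul_apply, h2, smul_eq_mul]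
    filter_upwards [h1, Lp.coeFn_finsetSum s fun h : H p => c h • modulate (h : Vilenkin p) F]
      with ω h1 h2
    rw [h2, Finset.sum_apply, trigPoly, Finset.sum_mul]
    exact Finset.sum_congr rfl fun h _ => by rw [h1 h, mul_assoc]
  rw [hn, ← lintegral_enorm_sq_eq, lintegral_congr_ae (g := fun ω => ‖trigPoly s c ω * F ω‖ₑ ^ 2)
    (hae.mono fun ω h => by rw [h]),
    lintegral_eq_setLIntegral_tsum (g := fun ω => ‖trigPoly s c ω * F ω‖ₑ ^ 2)
      ((hm.mul hF).enorm.pow_const 2)]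
  refine lintegral_congr fun ω => ?_
  simp_rw [trigPoly_add, enorm_mul, mul_pow]
  exact ENNReal.tsum_mul_left

/-- Parseval's identity for trigonometric polynomials on `U`. -/
theorem setLIntegral_enorm_trigPoly_sq (s : Finset (H p)) (c : H p → ℂ) :
    ∫⁻ ω in U p 0, ‖trigPoly s c ω‖ₑ ^ 2 ∂(haar p) = ENNReal.ofReal (∑ h ∈ s, ‖c h‖ ^ 2) := by
  classical
  have hc := continuous_trigPoly s c
  have hsq : ∀ ω, ((‖trigPoly s c ω‖ ^ 2 : ℝ) : ℂ) =
      ∑ h ∈ s, ∑ k ∈ s, conj (c h) * c k * character (h - k : Vilenkin p) ω := fun ω => by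
    rw [Complex.ofReal_pow, ← Complex.conj_mul', trigPoly, map_sum, Finset.sum_mul_sum]
    refine Finset.sum_congr rfl fun h _ => Finset.sum_congr rfl fun k _ => ?_
    rw [sub_eq_add_neg, character_add_left, character_neg_left, map_mul, Complex.conj_conj]
    ring
  have hI : ∀ (a : ℂ) (x : Vilenkin p),
      IntegrableOn (fun ω => a * character x ω) (U p 0) (haar p) := fun a x =>
    (integrableOn_U (continuous_character_right x) 0).const_mul a
  have hint : ∫ ω in U p 0, ‖trigPoly s c ω‖ ^ 2 ∂(haar p) = ∑ h ∈ s, ‖c h‖ ^ 2 := by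
    apply Complex.ofReal_injective
    rw [← integral_complex_ofReal]
    simp_rw [hsq]
    rw [integral_finsetSum _ fun h _ => integrable_finsetSum _ fun k _ => hI _ _,
      Complex.ofReal_sum]
    refine Finset.sum_congr rfl fun h hh => ?_
    rw [integral_finsetSum _ fun k _ => hI _ _]
    simp_rw [integral_const_mul, setIntegral_character_sub]
    simp only [mul_ite, mul_one, mul_zero, Finset.sum_ite_eq, hh, if_true]
    rw [Complex.conj_mul', Complex.ofReal_pow]
  rw [← hint, ofReal_integral_eq_lintegral_ofReal (f := fun ω => ‖trigPoly s c ω‖ ^ 2)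
    (integrableOn_U (g := fun ω => ‖trigPoly s c ω‖ ^ 2) (hc.norm.pow 2) 0)
    (Filter.Eventually.of_forall fun _ => by positivity)]
  exact lintegral_congr fun ω => by rw [ENNReal.ofReal_pow (norm_nonneg _), ofReal_norm]

end Vilenkin

namespace Vilenkin

variable {p : ℕ}

/-! ### Localization to cosets -/

/-- The element of `H` with entries `v 0, …, v (l - 1)` at the indices `0, -1, …, -(l - 1)`. -/
def digits {l : ℕ} (v : Fin l → ZMod p) : H p :=
  ⟨⟨fun j => if h : -l < j ∧ j ≤ 0 then v ⟨(-j).toNat, by omega⟩ else 0, -l,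
    fun j hj => dif_neg (by omega)⟩, fun j hj => dif_neg (by omega)⟩

theorem digits_mem_U {l : ℕ} (v : Fin l → ZMod p) : (digits v : Vilenkin p) ∈ U p (-l) :=
  fun _ hj => dif_neg (by omega)

theorem injective_digits (l : ℕ) : Function.Injective (digits (p := p) (l := l)) := by
  intro v w h
  ext i
  have hi : -(l : ℤ) < -(i : ℤ) ∧ -(i : ℤ) ≤ 0 := by omega
  have h1 : ∀ u : Fin l → ZMod p, (digits u : Vilenkin p) (-(i : ℤ)) = u i := fun u => by
    change (if h : -(l : ℤ) < -(i : ℤ) ∧ -(i : ℤ) ≤ 0 then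
      u ⟨(-(-(i : ℤ))).toNat, by omega⟩ else 0) = u i
    rw [dif_pos hi]
    congr 1
    ext
    simp
  rw [← h1 v, ← h1 w, h]

section Cosets

variable [NeZero p]

/-- A comparison of measures may be tested on the cosets of the groups `U_l`: an open set is an
increasing union of countable disjoint unions of cosets, and finite measures are outer regular. -/
theorem measure_le_of_coset_le (ν κ : Measure (Vilenkin p)) [IsFiniteMeasure κ]
    (h : ∀ (a : Vilenkin p) (l : ℕ), ν {x | x - a ∈ U p l} ≤ κ {x | x - a ∈ U p l}) :
    ν ≤ κ := by
  -- by outer regularity, it suffices to compare the measures of open sets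
  have hopen : ∀ W : Set (Vilenkin p), IsOpen W → ν W ≤ κ W := fun W hW => by
    -- `V l` is the union of the cosets of `U_l` that are contained in `W`
    let V : ℕ → Set (Vilenkin p) := fun l => {x | ∀ y, y - x ∈ U p l → y ∈ W}
    have hVW : ∀ l, V l ⊆ W := fun l x hx => hx x (by rw [sub_self]; exact fun _ _ => rfl)
    have hmono : Monotone V := fun k l hkl x hx y hy =>
      hx y (U_subset (by exact_mod_cast hkl) hy)
    have hW' : W = ⋃ l, V l := by
      refine Set.Subset.antisymm (fun x hx => ?_) (Set.iUnion_subset hVW)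
      obtain ⟨m, hm⟩ := mem_nhds_iff.1 (hW.mem_nhds hx)
      refine Set.mem_iUnion.2 ⟨m.toNat, fun y hy => hm y fun j hj => ?_⟩
      exact sub_mem_U_iff.1 hy j (by omega)
    have hV : ∀ l, ν (V l) ≤ κ (V l) := fun l => by
      -- truncation selects one representative in each coset of `U_l`
      let A : Set (Vilenkin p) := trunc l '' V l
      have hA : A.Countable := countable_finite_support.mono (by
        rintro _ ⟨x, -, rfl⟩
        exact finite_support_trunc l x)
      have hVA : V l = ⋃ a ∈ A, {x | x - a ∈ U p l} := by
        ext x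
        simp only [Set.mem_iUnion]
        constructor
        · exact fun hx => ⟨trunc l x, ⟨x, hx, rfl⟩, sub_trunc_mem_U l x⟩
        · rintro ⟨_, ⟨z, hz, rfl⟩, hx⟩ y hy
          refine hz y (sub_mem_U_iff.2 fun j hj => ?_)
          rw [sub_mem_U_iff.1 hy j hj, sub_mem_U_iff.1 hx j hj, trunc_apply, if_pos hj]
      have hdisj : A.PairwiseDisjoint fun a => {x | x - a ∈ U p l} := by
        rintro _ ⟨y, -, rfl⟩ _ ⟨z, -, rfl⟩ hne
        refine Set.disjoint_left.2 fun x hx hx' => hne (ext fun j => ?_)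
        by_cases hj : j ≤ l
        · exact (sub_mem_U_iff.1 hx j hj).symm.trans (sub_mem_U_iff.1 hx' j hj)
        · rw [trunc_apply, trunc_apply, if_neg hj, if_neg hj]
      have hmeas : ∀ a ∈ A, MeasurableSet {x | x - a ∈ U p l} := fun a _ =>
        (isOpen_coset a l).measurableSet
      rw [hVA, measure_biUnion hA hdisj hmeas, measure_biUnion hA hdisj hmeas]
      exact ENNReal.tsum_le_tsum fun a => h a l
    rw [hW', hmono.measure_iUnion]
    exact iSup_le fun l => (hV l).trans (measure_mono (Set.subset_iUnion V l))
  refine Measure.le_iff'.2 fun s => ?_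
  rw [s.measure_eq_iInf_isOpen κ]
  exact le_iInf₂ fun W hs => le_iInf fun hW => (measure_mono hs).trans (hopen W hW)

theorem haar_coset (a : Vilenkin p) (l : ℕ) :
    haar p {x | x - a ∈ U p l} = ((p : ℝ≥0∞) ^ l)⁻¹ := by
  have h1 : haar p {x | x - a ∈ U p l} = haar p (U p l) :=
    (measurePreserving_sub_right (haar p) a).measure_preimage
      (measurableSet_U l).nullMeasurableSet
  have h2 := haar_real_U (p := p) l
  have hp : (0 : ℝ) < (p : ℝ) ^ l := pow_pos (Nat.cast_pos.2 (NeZero.pos p)) l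
  rw [h1, ← ENNReal.ofReal_toReal (haar_U_ne_top (p := p) l), ← Measure.real, h2, zpow_neg,
    zpow_natCast, ENNReal.ofReal_inv_of_pos hp, ENNReal.ofReal_pow (Nat.cast_nonneg p),
    ENNReal.ofReal_natCast]

/-- If the family `T_h φ` satisfies the upper Riesz bound, then its bracket is bounded. On a coset
`a ⊕ U_l` of `U`, the bound is tested with the trigonometric polynomial that has the coefficients
`χ(h, a)` on the `p ^ l` elements `h` of `H ∩ U_{-l}`: it equals `p ^ l` on the coset. -/
theorem ae_ebracket_le {φ : L2 p} {D : ℝ} (hD : 0 < D)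
    (h : ∀ (s : Finset (H p)) (c : H p → ℂ),
      ‖∑ h ∈ s, c h • translate (h : Vilenkin p) φ‖ ^ 2 ≤ D * ∑ h ∈ s, ‖c h‖ ^ 2) :
    ∀ᵐ ω ∂(haar p).restrict (U p 0), ebracket (fourier φ) ω ≤ ENNReal.ofReal D := by
  set B := ebracket (fourier φ) with hBdef
  have hB : Measurable B := measurable_ebracket (Lp.stronglyMeasurable (fourier φ)).measurable
  have hfin : IsFiniteMeasure ((haar p).restrict (U p 0)) :=
    isFiniteMeasure_restrict.2 (haar_U_ne_top 0)
  have hfin' : IsFiniteMeasure (ENNReal.ofReal D • (haar p).restrict (U p 0)) :=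
    Measure.smul_finite _ ENNReal.ofReal_ne_top
  have hle : ((haar p).restrict (U p 0)).withDensity B ≤
      ENNReal.ofReal D • (haar p).restrict (U p 0) := by
    refine measure_le_of_coset_le _ _ fun a l => ?_
    set C : Set (Vilenkin p) := {x | x - a ∈ U p l} with hC
    have hCm : MeasurableSet C := (isOpen_coset a l).measurableSet
    rw [withDensity_apply _ hCm, Measure.restrict_restrict hCm, Measure.smul_apply,
      Measure.restrict_apply hCm, smul_eq_mul]
    by_cases ha : a ∈ U p 0
    · have hCU : C ⊆ U p 0 := fun x hx j hj => by
        rw [sub_mem_U_iff.1 hx j (by omega), ha j hj]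
      rw [Set.inter_eq_left.2 hCU, haar_coset]
      classical
      let s : Finset (H p) := Finset.univ.image (digits (p := p) (l := l))
      let c : H p → ℂ := fun h => character (h : Vilenkin p) a
      have hs : s.card = p ^ l := by
        rw [Finset.card_image_of_injective _ (injective_digits l)]
        simp
      have hm : ∀ ω ∈ C, trigPoly s c ω = (p : ℂ) ^ l := fun ω hω => by
        rw [trigPoly, Finset.sum_congr rfl (g := fun _ => (1 : ℂ)), Finset.sum_const, hs]
        · simp
        · intro h hh
          obtain ⟨v, -, rfl⟩ := Finset.mem_image.1 hh
          have h1 : character (digits v : Vilenkin p) (ω - a) = 1 :=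
            character_eq_one (digits_mem_U v) hω
          rw [sub_eq_add_neg, character_add_right, character_neg_right] at h1
          have h2 := congrArg conj h1
          rw [map_mul, Complex.conj_conj, map_one, mul_comm] at h2
          exact h2
      have hc : ∑ h ∈ s, ‖c h‖ ^ 2 = (p : ℝ) ^ l := by
        simp_rw [c, norm_character, one_pow, Finset.sum_const, hs]
        simp
      have h1 : ∫⁻ ω in U p 0, ‖trigPoly s c ω‖ₑ ^ 2 * B ω ∂(haar p) ≤
          ENNReal.ofReal D * (p : ℝ≥0∞) ^ l := by
        rw [hBdef, ← enorm_sum_translate_sq, ← ofReal_norm, ← ENNReal.ofReal_pow (norm_nonneg _)]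
        refine (ENNReal.ofReal_le_ofReal (h s c)).trans_eq ?_
        rw [hc, ENNReal.ofReal_mul hD.le, ENNReal.ofReal_pow (Nat.cast_nonneg p),
          ENNReal.ofReal_natCast]
      have h2 : ((p : ℝ≥0∞) ^ l) ^ 2 * ∫⁻ ω in C, B ω ∂(haar p) ≤
          ENNReal.ofReal D * (p : ℝ≥0∞) ^ l := by
        refine le_trans (le_of_eq ?_) ((lintegral_mono_set hCU).trans h1)
        rw [← lintegral_const_mul _ hB]
        refine setLIntegral_congr_fun hCm fun ω hω => ?_
        simp only [hm ω hω]
        rw [enorm_pow]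
        congr 3
        simp [enorm_eq_nnnorm]
      have hN0 : (p : ℝ≥0∞) ^ l ≠ 0 := pow_ne_zero _ (Nat.cast_ne_zero.2 (NeZero.ne p))
      have hNt : (p : ℝ≥0∞) ^ l ≠ ∞ := ENNReal.pow_ne_top (ENNReal.natCast_ne_top p)
      rw [← div_eq_mul_inv, ENNReal.le_div_iff_mul_le (Or.inl hN0) (Or.inl hNt)]
      rw [sq, mul_assoc, mul_comm (ENNReal.ofReal D), ENNReal.mul_le_mul_iff_right hN0 hNt] at h2
      rwa [mul_comm]
    · have hemp : C ∩ U p 0 = ∅ := by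
        refine Set.eq_empty_of_forall_notMem fun x hx => ha fun j hj => ?_
        rw [← sub_mem_U_iff.1 hx.1 j (by omega), hx.2 j hj]
      rw [hemp]
      simp
  refine ae_le_of_forall_setLIntegral_le_of_sigmaFinite hB fun s hs _ => ?_
  rw [setLIntegral_const, ← withDensity_apply _ hs]
  exact hle s

/-- A bounded bracket gives the upper Riesz bound, by Parseval's identity. -/
theorem norm_sum_translate_sq_le {φ : L2 p} {D : ℝ} (hD : 0 < D)
    (h : ∀ᵐ ω ∂(haar p).restrict (U p 0), ebracket (fourier φ) ω ≤ ENNReal.ofReal D)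
    (s : Finset (H p)) (c : H p → ℂ) :
    ‖∑ h ∈ s, c h • translate (h : Vilenkin p) φ‖ ^ 2 ≤ D * ∑ h ∈ s, ‖c h‖ ^ 2 := by
  rw [← ENNReal.ofReal_le_ofReal_iff (by positivity), ENNReal.ofReal_pow (norm_nonneg _),
    ofReal_norm, enorm_sum_translate_sq, ENNReal.ofReal_mul hD.le,
    ← setLIntegral_enorm_trigPoly_sq, ← lintegral_const_mul _
      ((continuous_trigPoly s c).measurable.enorm.pow_const 2)]
  refine lintegral_mono_ae ?_
  filter_upwards [h] with ω hω
  rw [mul_comm]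
  gcongr

end Cosets

end Vilenkin

theorem mainTheorem2 (p : ℕ) [NeZero p] (φ : Vilenkin.L2 p) (D : ℝ) (hD : 0 < D) :
    (∀ᵐ (ω : VilenkinDual p) ∂(Vilenkin.haar p).restrict (Vilenkin.U p 0),
      Summable fun h : Vilenkin.annihilatorH p => ‖Vilenkin.fourier φ (ω + h)‖ ^ 2) ∧
    List.TFAE
      [ IsBesselWithBound (fun h : Vilenkin.H p => Vilenkin.translate (h : Vilenkin p) φ) D,
        ∃ T : lp (fun _ : Vilenkin.H p => ℂ) 2 →L[ℂ] Vilenkin.L2 p,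
          IsSynthesisOperator
            (fun h : Vilenkin.H p => Vilenkin.translate (h : Vilenkin p) φ) T ∧ ‖T‖ ≤ √D,
        ∀ᵐ (ω : VilenkinDual p) ∂(Vilenkin.haar p).restrict (Vilenkin.U p 0),
          Vilenkin.bracket (Vilenkin.fourier φ) (Vilenkin.fourier φ) ω ≤ (D : ℂ) ] := by
  have hs : ∀ᵐ (ω : VilenkinDual p) ∂(Vilenkin.haar p).restrict (Vilenkin.U p 0),
      Summable fun h : Vilenkin.annihilatorH p => ‖Vilenkin.fourier φ (ω + h)‖ ^ 2 :=
    (Vilenkin.ae_ebracket_ne_top (Vilenkin.fourier φ)).mono fun ω hω =>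
      Vilenkin.summable_iff_ebracket_ne_top.2 hω
  refine ⟨hs, ?_⟩
  tfae_have 1 → 2 := fun h => h.exists_isSynthesisOperator
  tfae_have 2 → 3 := by
    rintro ⟨T, hT, hle⟩
    filter_upwards [hs, Vilenkin.ae_ebracket_le hD (hT.norm_sum_sq_le hD hle)] with ω h1 h2
    exact (Vilenkin.bracket_self_le_iff hD.le h1).2 h2
  tfae_have 3 → 1 := fun h => by
    refine isBesselWithBound_of_norm_sum_sq_le hD (Vilenkin.norm_sum_translate_sq_le hD ?_)
    filter_upwards [hs, h] with ω h1 h2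
    exact (Vilenkin.bracket_self_le_iff hD.le h1).1 h2
  tfae_finish
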